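/- Let $\sigma\in\mathbb C$ with $2\sigma\notin\mathbb Z$. For a partition $\lambda$ let $|\lambda|$ be its weight, $\ell(\lambda)$ the number of its nonzero parts, $\lambda'$ its transpose, and $h_\lambda(i,j)=\lambda_i-i+\lambda'_j-j+1$ the hook length of the box $(i,j)$ in row $i$ and column $j$ of its Young diagram. For partitions $\lambda,\mu$ put $$\mathcal B_{\lambda,\mu}([\,];\sigma)=\prod_{(i,j)\in\lambda}\frac{1}{h_\lambda(i,j)^2(\lambda'_j+\mu_i-i-j+1+2\sigma)^2}\prod_{(i,j)\in\mu}\frac{1}{h_\mu(i,j)^2(\lambda_i+\mu'_j-i-j+1-2\sigma)^2}.$$ For $q\in\mathbb C\setminus\{0\}$ and $u\in\mathbb C$ let $$\psi(u)=\psi_q(u)=\frac{q\,e^{u\sigma}}{\Gamma(1+2\sigma)^2}\,{}_0F_3\!\left(;1+2\sigma,1+2\sigma,1;e^u\right)+\frac{q^{-1}e^{-u\sigma}}{\Gamma(1-2\sigma)^2}\,{}_0F_3\!\left(;1-2\sigma,1-2\sigma,1;e^u\right),$$ where ${}_0F_3(;b_1,b_2,b_3;z)=\sum_{n\ge0}\frac{z^n}{(b_1)_n(b_2)_n(b_3)_n\,n!}$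 with $(b)_n=b(b+1)\cdots(b+n-1)$. (i) Both ${}_0F_3$ series converge absolutely for every $z\in\mathbb C$. For every $q\neq0$ the function $\psi_q$ is entire, and for every integer $K\ge1$ it is the moment generating function of the discrete complex measure $\nu_{[\,],K,\sigma;q}=q\sum_{k\ge0}w(k+\sigma)\delta_{k+\sigma}+q^{-1}\sum_{k\ge0}w(k-\sigma)\delta_{k-\sigma}$ with the weight $w(z)=w_{[\,],K,\sigma}(z)=\frac{1}{\Gamma(z+1+\sigma)^2\Gamma(z+1-\sigma)^2}$: for all $u\in\mathbb C$ the two series in $$\int e^{uz}\,d\nu_{[\,],K,\sigma;q}(z)=q\sum_{k\ge0}w(k+\sigma)e^{u(k+\sigma)}+q^{-1}\sum_{k\ge0}w(k-\sigma)e^{u(k-\sigma)}$$ converge absolutely and the value is $\psi_q(u)$. In particular it does not depend on $K$. (ii) For every integer $K\ge1$ and every $u\in\mathbb C$, with $t=e^u$, the sum over all pairs of partitions with at most $K$ parts each converges absolutely, the contour integral exists, and $$\sum_{\ell(\lambda)\le K,\ \ell(\mu)\le K}\mathcal B_{\lambda,\mu}([\,];\sigma)\,e^{u(|\lambda|+|\mu|)}=\frac{\Gamma(2\sigma)^{2K}\,\Gamma(1-2\sigma)^{2K}}{t^{K(K-1)}}\cdot\frac{1}{2\pi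 i}\oint_{|q|=1}\det\!\left(\psi_q^{(i+j-2)}(u)\right)_{i,j=1}^{2K}\frac{dq}{q},$$ where the derivatives of $\psi_q$ are taken in $u$ and the circle is traversed once counterclockwise. -/

import Mathlib

noncomputable section

namespace PainleveIII

/-- `P(a; z) = ∏ (z + aᵢ)`, equal to `1` for the empty list. -/
def P (a : List ℂ) (z : ℂ) : ℂ := (a.map fun c => z + c).prod

/-- `Γ(a; z) = ∏ Γ(z + aᵢ)`, equal to `1` for the empty list. -/
def GammaList (a : List ℂ) (z : ℂ) : ℂ := (a.map fun c => Complex.Gamma (z + c)).prod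

/-- The length `ℓ(Y)` of a partition, i.e. the number of its nonzero parts (rows). -/
def length (Y : YoungDiagram) : ℕ := Y.rowLens.length

/-- The hook length `h_Y(i, j) = Y_i - i + Y'_j - j + 1` of the box in row `i` and column `j`.
Mathlib numbers rows and columns from `0`, so the box `c` has `i = c.1 + 1`, `j = c.2 + 1`. -/
def hook (Y : YoungDiagram) (c : ℕ × ℕ) : ℂ :=
  (Y.rowLen c.1 : ℂ) - ((c.1 : ℂ) + 1) + (Y.colLen c.2 : ℂ) - ((c.2 : ℂ) + 1) + 1

/-- The product over the boxes `(i, j)` of `Y` of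
`P(a; i - j + s) / (h_Y(i, j)² (Y'_j + Z_i - i - j + 1 + 2 s)²)`. -/
def halfCoeff (a : List ℂ) (s : ℂ) (Y Z : YoungDiagram) : ℂ :=
  ∏ c ∈ Y.cells,
    P a (((c.1 : ℂ) + 1) - ((c.2 : ℂ) + 1) + s) /
      (hook Y c ^ 2 *
        ((Y.colLen c.2 : ℂ) + (Z.rowLen c.1 : ℂ)
          - ((c.1 : ℂ) + 1) - ((c.2 : ℂ) + 1) + 1 + 2 * s) ^ 2)

/-- The conformal block coefficient `B_{Y,Z}(a; σ)`. -/
def B (a : List ℂ) (σ : ℂ) (Y Z : YoungDiagram) : ℂ :=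
  halfCoeff a σ Y Z * halfCoeff a (-σ) Z Y

/-- The pairs of partitions both of whose lengths are at most `K`. -/
abbrev RestrictedPair (K : ℕ) : Type :=
  {p : YoungDiagram × YoungDiagram // length p.1 ≤ K ∧ length p.2 ≤ K}

/-- The weight `w(z) = 1 / (Γ(a; K - z) Γ(z + 1 + σ)² Γ(z + 1 - σ)²)`. -/
def weight (a : List ℂ) (K : ℕ) (σ z : ℂ) : ℂ :=
  1 / (GammaList a ((K : ℂ) - z) *
    Complex.Gamma (z + 1 + σ) ^ 2 * Complex.Gamma (z + 1 - σ) ^ 2)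

/-- `f` is integrable for the discrete complex measure `ν`: both of its series converge
absolutely. -/
def NuIntegrable (a : List ℂ) (K : ℕ) (σ : ℂ) (f : ℂ → ℂ) : Prop :=
  (Summable fun k : ℕ => weight a K σ (k + σ) * f (k + σ)) ∧
    Summable fun k : ℕ => weight a K σ (k - σ) * f (k - σ)

/-- The integral of `f` for the discrete complex measure
`ν = q ∑ₖ w(k + σ) δ_{k + σ} + q⁻¹ ∑ₖ w(k - σ) δ_{k - σ}`. -/
def nuIntegral (a : List ℂ) (K : ℕ) (σ q : ℂ) (f : ℂ → ℂ) : ℂ :=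
  q * (∑' k : ℕ, weight a K σ (k + σ) * f (k + σ)) +
    q⁻¹ * ∑' k : ℕ, weight a K σ (k - σ) * f (k - σ)

/-- The moment generating function `∫ e^{uz} dν(z)`. -/
def mgf (a : List ℂ) (K : ℕ) (σ q u : ℂ) : ℂ :=
  nuIntegral a K σ q fun z => Complex.exp (u * z)

/-- The `n`-th term of the generalized hypergeometric series with upper parameters `a` and lower
parameters `b`: `∏ (aᵢ)ₙ / ∏ (bⱼ)ₙ * zⁿ / n!`. -/
def hypTerm (a b : List ℂ) (z : ℂ) (n : ℕ) : ℂ :=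
  (a.map fun c => (ascPochhammer ℂ n).eval c).prod /
    (b.map fun c => (ascPochhammer ℂ n).eval c).prod * z ^ n / (n.factorial : ℂ)

/-- The generalized hypergeometric function `ₚF_r`. -/
def hyp (a b : List ℂ) (z : ℂ) : ℂ := ∑' n : ℕ, hypTerm a b z n

/-- The function
`ψ(u) = q e^{uσ} / Γ(1+2σ)² ₀F₃(; 1+2σ, 1+2σ, 1; e^u)
  + q⁻¹ e^{-uσ} / Γ(1-2σ)² ₀F₃(; 1-2σ, 1-2σ, 1; e^u)`. -/
def psi (σ q u : ℂ) : ℂ :=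
  q * Complex.exp (u * σ) / Complex.Gamma (1 + 2 * σ) ^ 2 *
      hyp [] [1 + 2 * σ, 1 + 2 * σ, 1] (Complex.exp u) +
    q⁻¹ * Complex.exp (-(u * σ)) / Complex.Gamma (1 - 2 * σ) ^ 2 *
      hyp [] [1 - 2 * σ, 1 - 2 * σ, 1] (Complex.exp u)

/-- The `2K × 2K` Hankel determinant of the derivatives `ψ^{(i+j-2)}(u)`, `1 ≤ i, j ≤ 2K`
(the indices in `Fin (2 * K)` start at `0`). -/
def hankel (K : ℕ) (ψ : ℂ → ℂ) (u : ℂ) : ℂ :=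
  (Matrix.of fun i j : Fin (2 * K) => iteratedDeriv ((i : ℕ) + (j : ℕ)) ψ u).det

end PainleveIII

end

/-!
The moments of the measure `ν` make the Hankel determinant of `ψ` a discrete `2K`-fold integral:
expanding `det (∫ z^{i+j} e^{uz} dν)` by multilinearity gives a sum over maps `f` from `Fin (2K)` to
the points of the two lattices `ℕ + σ` and `ℕ - σ`, in which a point of `ℕ + σ` carries a factor `q`
and a point of `ℕ - σ` a factor `q⁻¹` (`summable_norm_and_hasSum_hankelTerm`). The contour integral
keeps the constant term in `q`, that is the maps with `K` points on each lattice
(`hasSum_constant_term`). Non-injective maps contribute `0`, and the sum over the orderings of a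
fixed set of points is the product of the masses times the squared Vandermonde determinant
(`sum_perm_hankelTerm`).

A `K`-element subset of `ℕ` is the set of beta numbers `x_i = λ_i + K - i` of a unique partition `λ`
with at most `K` parts, so the surviving sets of points are the pairs of partitions
(`hasSum_config`). The lattices are assigned crosswise: the beta numbers `x_i` of `λ` give the points
`x_i - σ` and the beta numbers `y_i` of `μ` the points `y_i + σ`.

It remains to see that the coefficient `B_{λ,μ}` is the product of the weights of the points times
their squared Vandermonde determinant, up to the constant `(Γ(2σ) Γ(1 - 2σ))^{2K}` (`B_eq`). In the `i`-th row of `λ` the numbers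
`K - 1 + j - λ'_j`, `1 ≤ j ≤ λ_i`, are exactly the integers in `[0, x_i)` which are not beta numbers
(`prod_range_beta`). The hook lengths of that row are therefore the differences `x_i - m`, and the
mixed factors the differences `y_i + 2σ - m`, over these `m`. Products over all `m < x_i` are
factorials and quotients of Gamma functions, and the missing factors make up the Vandermonde
determinant; the reflection formula collects the remaining Gamma factors into `Γ(2σ) Γ(1 - 2σ)`, with
signs that disappear because everything is squared (`halfCoeff_mul_prod`, `prod_shift_sq_mul`).
-/

noncomputable section

namespace PainleveIII

/-! ### Beta numbers of a partition -/

/-- The beta numbers `Y_i + K - i`, `1 ≤ i ≤ K`, of a partition; here `i` is counted from `0`. -/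
def beta (K : ℕ) (Y : YoungDiagram) (i : Fin K) : ℕ := Y.rowLen i + (K - 1 - i)

lemma length_eq (Y : YoungDiagram) : length Y = Y.colLen 0 := YoungDiagram.length_rowLens

lemma colLen_le_length (Y : YoungDiagram) (j : ℕ) : Y.colLen j ≤ length Y :=
  length_eq Y ▸ Y.colLen_anti 0 j j.zero_le

lemma lt_rowLen_iff_lt_colLen (Y : YoungDiagram) (i j : ℕ) : j < Y.rowLen i ↔ i < Y.colLen j := by
  rw [← YoungDiagram.mem_iff_lt_rowLen, YoungDiagram.mem_iff_lt_colLen]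

lemma beta_strictAnti (K : ℕ) (Y : YoungDiagram) : StrictAnti (beta K Y) := by
  intro i k hik
  have := Y.rowLen_anti i k (Fin.le_def.mp hik.le)
  have := Fin.lt_def.mp hik
  simp only [beta]
  omega

lemma beta_injOn {K : ℕ} {Y Z : YoungDiagram} (hY : length Y ≤ K) (hZ : length Z ≤ K)
    (h : beta K Y = beta K Z) : Y = Z := by
  have key : ∀ i, Y.rowLen i = Z.rowLen i := by
    intro i
    by_cases hi : i < K
    · have := congrFun h ⟨i, hi⟩
      simp only [beta] at this
      omega
    · have aux : ∀ W : YoungDiagram, length W ≤ K → W.rowLen i = 0 := by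
        intro W hW
        by_contra h0
        have := (lt_rowLen_iff_lt_colLen W i 0).mp (Nat.pos_of_ne_zero h0)
        rw [← length_eq] at this
        omega
      rw [aux Y hY, aux Z hZ]
  ext ⟨i, j⟩
  rw [YoungDiagram.mem_cells, YoungDiagram.mem_cells, YoungDiagram.mem_iff_lt_rowLen,
    YoungDiagram.mem_iff_lt_rowLen, key]

lemma add_le_of_strictAnti {K : ℕ} {x : Fin K → ℕ} (hx : StrictAnti x) :
    ∀ (d : ℕ) (i k : Fin K), (k : ℕ) = i + d → x k + d ≤ x i := by
  intro d
  induction d with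
  | zero => intro i k h; rw [Fin.ext (a := k) (b := i) h, add_zero]
  | succ d ih =>
    intro i k h
    have h1 := ih i ⟨i + d, by omega⟩ rfl
    have h2 : x k < x ⟨i + d, by omega⟩ := hx (Fin.lt_def.mpr (by simp; omega))
    omega

/-- Every strictly decreasing sequence `x` of natural numbers is a sequence of beta numbers: the
partition has the rows `x_i - (K - i)`, with `i` counted from `1`. -/
lemma exists_beta_eq {K : ℕ} {x : Fin K → ℕ} (hx : StrictAnti x) :
    ∃ Y : YoungDiagram, length Y ≤ K ∧ beta K Y = x := by
  have hx' := add_le_of_strictAnti hx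
  set r : Fin K → ℕ := fun i => x i - (K - 1 - i) with hr
  have hanti : Antitone r := by
    intro i k hik
    have h1 := hx' (k - i) i k (by have := Fin.le_def.mp hik; omega)
    have := Fin.le_def.mp hik
    simp only [hr]
    omega
  have hw : (List.ofFn r).SortedGE := hanti.sortedGE_ofFn
  refine ⟨YoungDiagram.ofRowLens (List.ofFn r) hw, ?_, ?_⟩
  · by_contra! h
    rw [length_eq, ← YoungDiagram.mem_iff_lt_colLen, YoungDiagram.mem_ofRowLens] at h
    obtain ⟨h1, -⟩ := h
    simp at h1
  · funext i
    have h : (YoungDiagram.ofRowLens (List.ofFn r) hw).rowLen i = r i := by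
      rw [YoungDiagram.rowLen_ofRowLens (hw := hw) ⟨i, by simp⟩]
      simp
    have hi := i.isLt
    have h1 := hx' (K - 1 - i) i ⟨K - 1, by omega⟩ (by simp; omega)
    rw [beta, h]
    simp only [hr]
    omega

lemma prod_cells {M : Type*} [CommMonoid M] {K : ℕ} {Y : YoungDiagram} (hY : length Y ≤ K)
    (F : ℕ → ℕ → M) :
    ∏ c ∈ Y.cells, F c.1 c.2 = ∏ i : Fin K, ∏ j ∈ Finset.range (Y.rowLen i), F i j := by
  rw [Finset.prod_finset_product' Y.cells (Finset.range K) fun i => Finset.range (Y.rowLen i),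
    Finset.prod_range fun i => ∏ j ∈ Finset.range (Y.rowLen i), F i j]
  rintro ⟨i, j⟩
  simp only [YoungDiagram.mem_cells, Finset.mem_range, YoungDiagram.mem_iff_lt_rowLen,
    iff_and_self]
  intro h
  have := colLen_le_length Y j
  have := (lt_rowLen_iff_lt_colLen Y i j).mp h
  omega

lemma card_add_eq_sum_beta {K : ℕ} {Y : YoungDiagram} (hY : length Y ≤ K) :
    Y.card + K * (K - 1) / 2 = ∑ i, beta K Y i := by
  have h : Y.card = ∑ i : Fin K, Y.rowLen i := by
    have := prod_cells hY (M := Multiplicative ℕ) fun _ _ => Multiplicative.ofAdd 1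
    simpa [← ofAdd_nsmul, ← ofAdd_sum] using congrArg Multiplicative.toAdd this
  rw [h]
  simp only [beta, Finset.sum_add_distrib]
  congr 1
  rw [← Finset.sum_range fun i => K - 1 - i, Finset.sum_range_reflect fun i => i,
    Finset.sum_range_id]

/-- The integers `0, …, x_i - 1` below the beta number `x_i` are the later beta numbers together
with the numbers `K + j - Y'_j`, one for each box of the `i`-th row (rows and columns are counted
from `0`). -/
lemma prod_range_beta {M : Type*} [CommMonoid M] {K : ℕ} {Y : YoungDiagram} (hY : length Y ≤ K)
    (i : Fin K) (φ : ℕ → M) :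
    ∏ m ∈ Finset.range (beta K Y i), φ m =
      (∏ j ∈ Finset.range (Y.rowLen i), φ (K + j - Y.colLen j)) *
        ∏ k ∈ Finset.Ioi i, φ (beta K Y k) := by
  classical
  have hcol : ∀ j, Y.colLen j ≤ K := fun j => (colLen_le_length Y j).trans hY
  have inj1 : Set.InjOn (fun j => K + j - Y.colLen j) (Finset.range (Y.rowLen i)) := by
    refine StrictMono.injective (fun a b hab => ?_) |>.injOn
    have := Y.colLen_anti a b hab.le
    have := hcol a
    have := hcol b
    show K + a - _ < K + b - _
    omega
  have inj2 : Set.InjOn (beta K Y) (Finset.Ioi i) := (beta_strictAnti K Y).injective.injOn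
  have hdisj : Disjoint ((Finset.range (Y.rowLen i)).image fun j => K + j - Y.colLen j)
      ((Finset.Ioi i).image (beta K Y)) := by
    rw [Finset.disjoint_left]
    intro m hm hm'
    obtain ⟨j, -, rfl⟩ := Finset.mem_image.mp hm
    obtain ⟨k, -, hk⟩ := Finset.mem_image.mp hm'
    have h1 := hcol j
    have h2 := lt_rowLen_iff_lt_colLen Y k j
    simp only [beta] at hk
    by_cases h3 : j < Y.rowLen k
    · have := h2.mp h3
      omega
    · have := mt h2.mpr h3
      omega
  rw [← Finset.prod_image inj1, ← Finset.prod_image inj2, ← Finset.prod_union hdisj]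
  refine Finset.prod_congr ?_ fun _ _ => rfl
  symm
  -- One inclusion is clear, and both sides have `Y_i + K - 1 - i` elements.
  apply Finset.eq_of_subset_of_card_le
  · intro m hm
    rw [Finset.mem_union, Finset.mem_image, Finset.mem_image] at hm
    rw [Finset.mem_range]
    rcases hm with ⟨j, hj, rfl⟩ | ⟨k, hk, rfl⟩
    · rw [Finset.mem_range] at hj
      have := (lt_rowLen_iff_lt_colLen Y i j).mp hj
      simp only [beta]
      omega
    · exact beta_strictAnti K Y (Finset.mem_Ioi.mp hk)
  · rw [Finset.card_union_of_disjoint hdisj, Finset.card_image_of_injOn inj1,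
      Finset.card_image_of_injOn inj2]
    simp [beta]

/-! ### Coefficients of the conformal block in beta numbers -/

lemma Gamma_add_one_eq_prod_mul (z : ℂ) (x : ℕ) (hz : ∀ m : ℕ, m < x → z ≠ m) :
    Complex.Gamma (z + 1) = (∏ m ∈ Finset.range x, (z - m)) * Complex.Gamma (z - x + 1) := by
  induction x with
  | zero => simp
  | succ x ih =>
    rw [ih fun m hm => hz m (hm.trans x.lt_succ_self), Finset.prod_range_succ,
      Complex.Gamma_add_one (z - x) (sub_ne_zero.mpr (hz x x.lt_succ_self))]
    push_cast
    rw [show z - (x + 1) + 1 = z - x by ring]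
    ring

/-- Up to sign, Euler's reflection product `Γ(s) Γ(1 - s)` has period `1`. -/
lemma Gamma_reflection_add_int_sq (s : ℂ) (n : ℤ) :
    (Complex.Gamma (s + n) * Complex.Gamma (1 - (s + n))) ^ 2 =
      (Complex.Gamma s * Complex.Gamma (1 - s)) ^ 2 := by
  rw [Complex.Gamma_mul_Gamma_one_sub, Complex.Gamma_mul_Gamma_one_sub, div_pow, div_pow]
  congr 1
  rw [mul_add, mul_comm (Real.pi : ℂ) n, Complex.sin_add, Complex.sin_int_mul_pi, mul_zero,
    add_zero, mul_pow]
  have h := Complex.sin_sq_add_cos_sq ((n : ℂ) * Real.pi)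
  rw [Complex.sin_int_mul_pi] at h
  rw [show Complex.cos ((n : ℂ) * Real.pi) ^ 2 = 1 by linear_combination h, mul_one]

/-- The factors of `B_{λ,μ}` that involve only the `i`-th beta numbers `x` of `λ` and `y` of `μ`, in
terms of Gamma functions. -/
lemma prod_shift_sq_mul (s : ℂ) (hs : ∀ n : ℤ, s ≠ n) (x y : ℕ) :
    ((∏ m ∈ Finset.range x, (y + s - m)) * ∏ m ∈ Finset.range y, (x - s - m)) ^ 2 *
        (y + s - x) ^ 2 * (Complex.Gamma s * Complex.Gamma (1 - s)) ^ 2 =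
      (Complex.Gamma (y + s + 1) * Complex.Gamma (x - s + 1)) ^ 2 := by
  have h1 := Gamma_add_one_eq_prod_mul (y + s) x fun m _ h =>
    hs (m - y) (by push_cast; linear_combination h)
  have h2 := Gamma_add_one_eq_prod_mul (x - s) y fun m _ h =>
    hs (x - m) (by push_cast; linear_combination -h)
  have h3 := Gamma_reflection_add_int_sq s (y - x)
  have h4 : (y : ℂ) + s - x ≠ 0 := fun h => hs (x - y) (by push_cast; linear_combination h)
  push_cast at h3
  rw [h1, h2, ← h3, Complex.Gamma_add_one _ h4, show s + ((y : ℂ) - x) = y + s - x by ring,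
    show 1 - ((y : ℂ) + s - x) = x - s - y + 1 by ring]
  ring

/-- The boxes of `Y` leave out the factors at the later beta numbers of `Y` from the full products
over `0, …, x_i - 1`. -/
lemma halfCoeff_mul_prod {K : ℕ} {Y : YoungDiagram} (Z : YoungDiagram) (hY : length Y ≤ K)
    (σ : ℂ) (hσ : ∀ n : ℤ, 2 * σ ≠ n) :
    halfCoeff [] σ Y Z *
        ∏ i, ((beta K Y i).factorial *
          ∏ m ∈ Finset.range (beta K Y i), (beta K Z i + 2 * σ - m)) ^ 2 =
      ∏ i, ∏ k ∈ Finset.Ioi i, (((beta K Y i : ℂ) - beta K Y k) *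
        (beta K Z i + 2 * σ - beta K Y k)) ^ 2 := by
  have hfac : ∀ x : ℕ, (x.factorial : ℂ) = ∏ m ∈ Finset.range x, ((x : ℂ) - m) := by
    intro x
    have := Gamma_add_one_eq_prod_mul x x fun m hm => by exact_mod_cast hm.ne'
    rwa [sub_self, zero_add, Complex.Gamma_one, mul_one, Complex.Gamma_nat_eq_factorial] at this
  set Φ : Fin K → ℕ → ℂ := fun i m =>
    (((beta K Y i : ℂ) - m) * (beta K Z i + 2 * σ - m)) ^ 2 with hΦ
  have hhalf : halfCoeff [] σ Y Z =
      ∏ i : Fin K, (∏ j ∈ Finset.range (Y.rowLen i), Φ i (K + j - Y.colLen j))⁻¹ := by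
    have := prod_cells hY fun i j => (1 : ℂ) / (hook Y (i, j) ^ 2 *
        ((Y.colLen j : ℂ) + (Z.rowLen i : ℂ) - ((i : ℂ) + 1) - ((j : ℂ) + 1) + 1 + 2 * σ) ^ 2)
    simp only [halfCoeff, P, List.map_nil, List.prod_nil]
    rw [this]
    refine Finset.prod_congr rfl fun i _ => ?_
    rw [← Finset.prod_inv_distrib]
    refine Finset.prod_congr rfl fun j _ => ?_
    have hc : Y.colLen j ≤ K + j := ((colLen_le_length Y j).trans hY).trans (Nat.le_add_right _ _)
    have hi : (i : ℕ) ≤ K - 1 := by omega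
    have hK : 1 ≤ K := by omega
    simp only [hΦ, hook, beta]
    rw [one_div, ← mul_pow]
    push_cast [hc, hi, hK]
    congr 2
    ring
  rw [hhalf, ← Finset.prod_mul_distrib]
  refine Finset.prod_congr rfl fun i _ => ?_
  -- `Φ i` has no zero below `x_i`, so the full product can be divided by the product over the row.
  have hR := prod_range_beta hY i (Φ i)
  have hR' : ∏ m ∈ Finset.range (beta K Y i), Φ i m = ((beta K Y i).factorial *
          ∏ m ∈ Finset.range (beta K Y i), (beta K Z i + 2 * σ - m)) ^ 2 := by
    rw [hfac, ← Finset.prod_mul_distrib, ← Finset.prod_pow]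
  have hne : ∏ m ∈ Finset.range (beta K Y i), Φ i m ≠ 0 := by
    refine Finset.prod_ne_zero_iff.mpr fun m hm => pow_ne_zero _ (mul_ne_zero ?_ fun h => ?_)
    · rw [sub_ne_zero]
      exact_mod_cast (Finset.mem_range.mp hm).ne'
    · exact hσ (m - beta K Z i) (by push_cast; linear_combination h)
  rw [← hR', hR, inv_mul_cancel_left₀]
  rw [hR] at hne
  exact left_ne_zero_of_mul hne

lemma weight_nil (K : ℕ) (σ z : ℂ) : weight [] K σ z =
    (Complex.Gamma (z + 1 + σ) ^ 2 * Complex.Gamma (z + 1 - σ) ^ 2)⁻¹ := by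
  simp [weight, GammaList]

lemma prod_prod_eq_prod_Ioi_mul_diag {K : ℕ} (F : Fin K → Fin K → ℂ) :
    ∏ i, ∏ k, F i k = (∏ i, ∏ k ∈ Finset.Ioi i, F k i * F i k) * ∏ i, F i i := by
  rw [Finset.prod_prod_Ioi_mul_eq_prod_prod_off_diag, Finset.prod_comm,
    ← Finset.prod_mul_distrib]
  refine Finset.prod_congr rfl fun i _ => ?_
  rw [mul_comm, ← Finset.prod_singleton (fun j => F j i) i, Finset.prod_mul_prod_compl]

/-- The increasing identification of two copies of `Fin K`, placed one after the other, with
`Fin (2 * K)`. -/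
def doubleEquiv (K : ℕ) : Fin K ⊕ Fin K ≃ Fin (2 * K) :=
  finSumFinEquiv.trans (finCongr (two_mul K).symm)

lemma det_vandermonde_sum_sq {K : ℕ} (a b : Fin K → ℂ) :
    (Matrix.vandermonde (Sum.elim a b ∘ (doubleEquiv K).symm)).det ^ 2 =
      (∏ i, ∏ k ∈ Finset.Ioi i, ((a i - a k) * (b i - b k)) ^ 2) *
        ∏ i, ∏ k, (a i - b k) ^ 2 := by
  have key : ∀ {N : ℕ} (h : K + K = N),
      (Matrix.vandermonde (Sum.elim a b ∘ (finSumFinEquiv.trans (finCongr h)).symm)).det ^ 2 =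
      (∏ i, ∏ k ∈ Finset.Ioi i, ((a i - a k) * (b i - b k)) ^ 2) *
        ∏ i, ∏ k, (a i - b k) ^ 2 := by
    rintro _ rfl
    have hIoi : ∀ {n : ℕ} (i : Fin n) (F : Fin n → ℂ),
        ∏ k ∈ Finset.Ioi i, F k = ∏ k, if i < k then F k else 1 := by
      intro n i F
      rw [← Finset.prod_filter]
      congr 1
      ext
      simp
    have l1 : ∀ i k : Fin K, Fin.castAdd K i < Fin.castAdd K k ↔ i < k := fun i k => Iff.rfl
    have l2 : ∀ i k : Fin K, Fin.castAdd K i < Fin.natAdd K k ↔ True := fun i k => by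
      simp only [Fin.lt_def, Fin.val_castAdd, Fin.val_natAdd, iff_true]
      omega
    have l3 : ∀ i k : Fin K, Fin.natAdd K i < Fin.castAdd K k ↔ False := fun i k => by
      simp only [Fin.lt_def, Fin.val_castAdd, Fin.val_natAdd, iff_false]
      omega
    have l4 : ∀ i k : Fin K, Fin.natAdd K i < Fin.natAdd K k ↔ i < k := fun i k => by
      simp only [Fin.lt_def, Fin.val_natAdd]
      omega
    simp only [Matrix.det_vandermonde, hIoi, Fin.prod_univ_add, l1, l2, l3, l4, if_true, if_false,
      one_mul, Function.comp_apply, Equiv.symm_trans_apply, Equiv.refl_symm,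
      finCongr_refl, Equiv.refl_apply, finSumFinEquiv_symm_apply_castAdd,
      finSumFinEquiv_symm_apply_natAdd, Sum.elim_inl, Sum.elim_inr, ← Finset.prod_pow,
      ← Finset.prod_mul_distrib, mul_pow]
    refine Finset.prod_congr rfl fun i _ => Finset.prod_congr rfl fun k _ => ?_
    split_ifs <;> ring
  exact key _

/-- The block coefficient is the product of the weights of the points `y_i + σ`, `x_i - σ` and of
their squared Vandermonde determinant, up to a constant. -/
theorem B_eq {K : ℕ} {Y Z : YoungDiagram} (hY : length Y ≤ K) (hZ : length Z ≤ K)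
    (σ : ℂ) (hσ : ∀ n : ℤ, 2 * σ ≠ n) :
    B [] σ Y Z = (Complex.Gamma (2 * σ) ^ (2 * K) * Complex.Gamma (1 - 2 * σ) ^ (2 * K)) *
      ((∏ i, (weight [] K σ (beta K Z i + σ) * weight [] K σ (beta K Y i - σ))) *
      (Matrix.vandermonde (Sum.elim (fun i => (beta K Z i : ℂ) + σ) (fun i => beta K Y i - σ) ∘
        (doubleEquiv K).symm)).det ^ 2) := by
  have h1 := halfCoeff_mul_prod Z hY σ hσ
  have h2 := halfCoeff_mul_prod Y hZ (-σ) fun n h => hσ (-n) (by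
    push_cast; linear_combination -h)
  have h3 : B [] σ Y Z * ∏ i, (((beta K Y i).factorial *
        ∏ m ∈ Finset.range (beta K Y i), ((beta K Z i : ℂ) + 2 * σ - m)) ^ 2 *
      ((beta K Z i).factorial *
        ∏ m ∈ Finset.range (beta K Z i), ((beta K Y i : ℂ) + 2 * -σ - m)) ^ 2) =
      ∏ i, ∏ k ∈ Finset.Ioi i, ((((beta K Y i : ℂ) - beta K Y k) *
        (beta K Z i + 2 * σ - beta K Y k)) ^ 2 * (((beta K Z i : ℂ) - beta K Z k) *
        (beta K Y i + 2 * -σ - beta K Z k)) ^ 2) := by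
    simp only [Finset.prod_mul_distrib] at h1 h2 ⊢
    rw [← h1, ← h2, B]
    ring
  -- The factors that do not involve two different indices cancel for each index separately.
  have hdiag : ∀ i, (Complex.Gamma (2 * σ) ^ 2 * Complex.Gamma (1 - 2 * σ) ^ 2) *
      (weight [] K σ (beta K Z i + σ) * weight [] K σ (beta K Y i - σ)) *
      ((beta K Z i : ℂ) + σ - (beta K Y i - σ)) ^ 2 * (((beta K Y i).factorial *
        ∏ m ∈ Finset.range (beta K Y i), ((beta K Z i : ℂ) + 2 * σ - m)) ^ 2 *
      ((beta K Z i).factorial *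
        ∏ m ∈ Finset.range (beta K Z i), ((beta K Y i : ℂ) + 2 * -σ - m)) ^ 2) = 1 := by
    intro i
    have h := prod_shift_sq_mul (2 * σ) hσ (beta K Y i) (beta K Z i)
    have g1 : Complex.Gamma (beta K Z i + 2 * σ + 1) ≠ 0 := Complex.Gamma_ne_zero fun m hm =>
      hσ (-m - 1 - beta K Z i) (by push_cast; linear_combination hm)
    have g2 : Complex.Gamma (beta K Y i - 2 * σ + 1) ≠ 0 := Complex.Gamma_ne_zero fun m hm =>
      hσ (m + 1 + beta K Y i) (by push_cast; linear_combination -hm)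
    have f1 : ((beta K Y i).factorial : ℂ) ≠ 0 := by exact_mod_cast (beta K Y i).factorial_ne_zero
    have f2 : ((beta K Z i).factorial : ℂ) ≠ 0 := by exact_mod_cast (beta K Z i).factorial_ne_zero
    rw [weight_nil, weight_nil,
      show (beta K Z i : ℂ) + σ + 1 + σ = beta K Z i + 2 * σ + 1 by ring,
      show (beta K Z i : ℂ) + σ + 1 - σ = beta K Z i + 1 by ring,
      show (beta K Y i : ℂ) - σ + 1 + σ = beta K Y i + 1 by ring,
      show (beta K Y i : ℂ) - σ + 1 - σ = beta K Y i - 2 * σ + 1 by ring,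
      Complex.Gamma_nat_eq_factorial, Complex.Gamma_nat_eq_factorial]
    simp only [mul_neg, ← sub_eq_add_neg]
    field_simp
    linear_combination h
  have hD := fun i => right_ne_zero_of_mul_eq_one (hdiag i)
  rw [det_vandermonde_sum_sq, prod_prod_eq_prod_Ioi_mul_diag]
  apply mul_right_cancel₀ (Finset.prod_ne_zero_iff.mpr fun i _ => hD i)
  have hprod := Finset.prod_congr rfl fun i (_ : i ∈ Finset.univ) => hdiag i
  rw [Finset.prod_mul_distrib, Finset.prod_mul_distrib, Finset.prod_mul_distrib,
    Finset.prod_const, Finset.card_univ, Fintype.card_fin, Finset.prod_const_one] at hprod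
  rw [h3, pow_mul, pow_mul, ← mul_pow]
  have hoff : ∏ i, ∏ k ∈ Finset.Ioi i, ((((beta K Y i : ℂ) - beta K Y k) *
        (beta K Z i + 2 * σ - beta K Y k)) ^ 2 * (((beta K Z i : ℂ) - beta K Z k) *
        (beta K Y i + 2 * -σ - beta K Z k)) ^ 2) =
      (∏ i, ∏ k ∈ Finset.Ioi i, (((beta K Z i : ℂ) + σ - (beta K Z k + σ)) *
        (beta K Y i - σ - (beta K Y k - σ))) ^ 2) *
      ∏ i, ∏ k ∈ Finset.Ioi i, ((beta K Z k : ℂ) + σ - (beta K Y i - σ)) ^ 2 *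
        ((beta K Z i : ℂ) + σ - (beta K Y k - σ)) ^ 2 := by
    simp only [← Finset.prod_mul_distrib]
    refine Finset.prod_congr rfl fun i _ => Finset.prod_congr rfl fun k _ => ?_
    ring
  rw [hoff]
  generalize (∏ i, ∏ k ∈ Finset.Ioi i, (((beta K Z i : ℂ) + σ - (beta K Z k + σ)) *
    (beta K Y i - σ - (beta K Y k - σ))) ^ 2) = p
  generalize (∏ i, ∏ k ∈ Finset.Ioi i, ((beta K Z k : ℂ) + σ - (beta K Y i - σ)) ^ 2 *
    ((beta K Z i : ℂ) + σ - (beta K Y k - σ)) ^ 2) = p'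
  linear_combination -(p * p') * hprod

/-! ### Hankel determinants of discrete measures -/

lemma summable_norm_and_hasSum_prod_pi {ι : Type*} {N : ℕ} (b : Fin N → ι → ℂ)
    (hb : ∀ i, Summable fun x => ‖b i x‖) :
    (Summable fun f : Fin N → ι => ‖∏ i, b i (f i)‖) ∧
      HasSum (fun f : Fin N → ι => ∏ i, b i (f i)) (∏ i, ∑' x, b i x) := by
  induction N with
  | zero =>
    refine ⟨Summable.of_finite, ?_⟩
    simp
  | succ N ih =>
    obtain ⟨h1, h2⟩ := ih (fun i => b i.succ) fun i => hb i.succ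
    let C : ι × (Fin N → ι) ≃ (Fin (N + 1) → ι) := Fin.consEquiv (n := N) (fun _ => ι)
    have e : ∀ y : ι × (Fin N → ι), ∏ i, b i (C y i) = b 0 y.1 * ∏ i : Fin N, b i.succ (y.2 i) :=
      fun y => by rw [Fin.prod_univ_succ]; rfl
    constructor
    · rw [← C.summable_iff]
      simp only [Function.comp_def, e]
      have hs := Summable.mul_norm (hb 0) h1
      exact hs
    · rw [← C.hasSum_iff, Fin.prod_univ_succ]
      simp only [Function.comp_def, e]
      have hs := summable_mul_of_summable_norm (hb 0) h1
      have h0 : HasSum (b 0) (∑' x, b 0 x) := (Summable.of_norm (hb 0)).hasSum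
      have hm := h0.mul h2 hs
      exact hm

/-- One summand `∏ a(f i) z(f i)^i · Δ(z ∘ f)` in the expansion of the Hankel determinant of the
measure `∑ a(x) δ_{z(x)}` along its rows. -/
def hankelTerm {ι : Type*} {N : ℕ} (a z : ι → ℂ) (f : Fin N → ι) : ℂ :=
  (∏ i, a (f i) * z (f i) ^ (i : ℕ)) * (Matrix.vandermonde (z ∘ f)).det

lemma hankelTerm_eq_sum {ι : Type*} {N : ℕ} (a z : ι → ℂ) (f : Fin N → ι) :
    hankelTerm a z f = ∑ π : Equiv.Perm (Fin N), ((Equiv.Perm.sign π : ℤ) : ℂ) *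
      ∏ i, a (f i) * z (f i) ^ ((π i : ℕ) + i) := by
  rw [hankelTerm, ← Matrix.det_transpose, Matrix.det_apply', Finset.mul_sum]
  refine Finset.sum_congr rfl fun π _ => ?_
  rw [mul_left_comm, ← Finset.prod_mul_distrib]
  congr 1
  refine Finset.prod_congr rfl fun i _ => ?_
  simp only [Matrix.transpose_apply, Matrix.vandermonde_apply, Function.comp_apply]
  ring

/-- Multilinear expansion of the Hankel determinant of the moments of `∑ a(x) δ_{z(x)}`. -/
lemma summable_norm_and_hasSum_hankelTerm {ι : Type*} {N : ℕ} (a z : ι → ℂ)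
    (h : ∀ n : ℕ, Summable fun x => ‖a x * z x ^ n‖) :
    (Summable fun f : Fin N → ι => ‖hankelTerm a z f‖) ∧
      HasSum (fun f : Fin N → ι => hankelTerm a z f)
        (Matrix.of fun i j : Fin N => ∑' x, a x * z x ^ ((i : ℕ) + j)).det := by
  have key := fun π : Equiv.Perm (Fin N) => summable_norm_and_hasSum_prod_pi
    (fun (i : Fin N) x => a x * z x ^ ((π i : ℕ) + i)) fun i => h _
  simp only [hankelTerm_eq_sum]
  constructor
  · refine Summable.of_nonneg_of_le (fun _ => norm_nonneg _) (fun f => norm_sum_le _ _) ?_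
    refine summable_sum fun π _ => ?_
    simp only [norm_mul _ (Finset.prod _ _)]
    exact (key π).1.mul_left _
  · rw [Matrix.det_apply']
    exact hasSum_sum fun π _ => (key π).2.mul_left _

lemma hankelTerm_eq_zero_of_not_injective {ι : Type*} {N : ℕ} (a z : ι → ℂ) {f : Fin N → ι}
    (hf : ¬ Function.Injective f) : hankelTerm a z f = 0 := by
  rw [hankelTerm, Matrix.det_vandermonde_eq_zero_iff.mpr, mul_zero]
  simp only [Function.Injective, not_forall] at hf
  obtain ⟨i, j, hij, hne⟩ := hf
  exact ⟨i, j, congrArg z hij, hne⟩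

/-- Antisymmetrization over the orderings of the points turns the monomial into a second
Vandermonde determinant. -/
lemma sum_perm_hankelTerm {ι : Type*} {N : ℕ} (a z : ι → ℂ) (f : Fin N → ι) :
    ∑ π : Equiv.Perm (Fin N), hankelTerm a z (f ∘ π) =
      (∏ i, a (f i)) * (Matrix.vandermonde (z ∘ f)).det ^ 2 := by
  have h : ∀ π : Equiv.Perm (Fin N), hankelTerm a z (f ∘ π) = (∏ i, a (f i)) *
      ((Matrix.vandermonde (z ∘ f)).det *
        (((Equiv.Perm.sign π : ℤ) : ℂ) * ∏ i, Matrix.vandermonde (z ∘ f) (π i) i)) := by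
    intro π
    have hV : Matrix.vandermonde (z ∘ f ∘ π) = (Matrix.vandermonde (z ∘ f)).submatrix π id := rfl
    rw [hankelTerm, hV, Matrix.det_permute, Finset.prod_mul_distrib]
    simp only [Function.comp_apply, Matrix.vandermonde_apply]
    rw [Equiv.prod_comp π fun i => a (f i)]
    ring
  rw [Finset.sum_congr rfl fun π _ => h π, ← Finset.mul_sum, ← Finset.mul_sum,
    ← Matrix.det_apply', sq]

/-! ### Extraction of the constant term by a contour integral -/

lemma integral_zpow_div_self (n : ℤ) (c : ℂ) :
    (2 * (Real.pi : ℂ) * Complex.I)⁻¹ * ∮ q in C(0, 1), q ^ n * c / q = if n = 0 then c else 0 := by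
  have h : Set.EqOn (fun q : ℂ => q ^ n * c / q) (fun q => c * (q - 0) ^ (n - 1))
      (Metric.sphere 0 1) := by
    intro q hq
    have hq0 : q ≠ 0 := ne_zero_of_mem_unit_sphere (⟨q, hq⟩ : Metric.sphere (0 : ℂ) 1)
    simp only [sub_zero, zpow_sub_one₀ hq0]
    ring
  rw [circleIntegral.integral_congr zero_le_one h, circleIntegral.integral_const_mul]
  split_ifs with hn
  · subst hn
    simp only [zero_sub, zpow_neg_one]
    rw [circleIntegral.integral_sub_center_inv _ one_ne_zero]
    field_simp [Complex.two_pi_I_ne_zero]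
  · rw [circleIntegral.integral_sub_zpow_of_ne (by omega), mul_zero, mul_zero]

lemma hasSum_constant_term {ι : Type*} [Countable ι] {G : ι → ℂ} (hG : Summable fun x => ‖G x‖)
    (E : ι → ℤ) {H : ℂ → ℂ} (hH : ∀ q : ℂ, q ≠ 0 → HasSum (fun x => q ^ E x * G x) (H q)) :
    HasSum (fun x => if E x = 0 then G x else 0)
      ((2 * (Real.pi : ℂ) * Complex.I)⁻¹ * ∮ q in C(0, 1), H q / q) := by
  simp only [← integral_zpow_div_self]
  apply HasSum.mul_left
  simp only [circleIntegral]
  have hc : ∀ θ : ℝ, circleMap 0 1 θ ≠ 0 := fun θ => circleMap_ne_center one_ne_zero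
  have hn : ∀ θ : ℝ, ‖circleMap 0 1 θ‖ = 1 := fun θ => by simp
  refine intervalIntegral.hasSum_integral_of_dominated_convergence (fun x _ => ‖G x‖) ?_ ?_ ?_ ?_ ?_
  · intro x
    apply Continuous.aestronglyMeasurable
    have : Continuous fun θ => circleMap 0 1 θ ^ E x :=
      (continuous_circleMap 0 1).zpow₀ _ fun θ => Or.inl (hc θ)
    simp only [deriv_circleMap, smul_eq_mul]
    exact ((continuous_circleMap 0 1).mul continuous_const).mul
      ((this.mul continuous_const).div (continuous_circleMap 0 1) hc)
  · intro x
    refine Filter.Eventually.of_forall fun θ _ => ?_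
    simp [deriv_circleMap, hn]
  · exact Filter.Eventually.of_forall fun θ _ => hG
  · exact intervalIntegrable_const
  · refine Filter.Eventually.of_forall fun θ _ => ?_
    simp only [smul_eq_mul]
    exact ((hH _ (hc θ)).div_const _).mul_left _

/-! ### Balanced configurations of points and pairs of partitions -/

/-- The charge of a point: `1` on the lattice `ℕ + σ` (the left summand), `-1` on `ℕ - σ`. -/
def charge : ℕ ⊕ ℕ → ℤ := Sum.elim (fun _ => 1) fun _ => -1

/-- The points of a pair `(λ, μ)`: the beta numbers of `μ` on the lattice `ℕ + σ`, followed by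
those of `λ` on the lattice `ℕ - σ`. -/
def config {K : ℕ} (p : RestrictedPair K) : Fin (2 * K) → ℕ ⊕ ℕ :=
  Sum.map (beta K p.1.2) (beta K p.1.1) ∘ (doubleEquiv K).symm

lemma config_injective {K : ℕ} (p : RestrictedPair K) : Function.Injective (config p) :=
  (Sum.map_injective.mpr ⟨(beta_strictAnti K _).injective, (beta_strictAnti K _).injective⟩).comp
    (doubleEquiv K).symm.injective

lemma prod_config {M : Type*} [CommMonoid M] {K : ℕ} (p : RestrictedPair K) (F : ℕ ⊕ ℕ → M) :
    ∏ i, F (config p i) =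
      (∏ i, F (Sum.inl (beta K p.1.2 i))) * ∏ i, F (Sum.inr (beta K p.1.1 i)) := by
  rw [← Equiv.prod_comp (doubleEquiv K), Fintype.prod_sum_type]
  simp [config]

lemma sum_charge_config {K : ℕ} (p : RestrictedPair K) : ∑ i, charge (config p i) = 0 := by
  rw [← Equiv.sum_comp (doubleEquiv K), Fintype.sum_sum_type]
  simp [config, charge]

lemma range_config {K : ℕ} (p : RestrictedPair K) : Set.range (config p) =
    Sum.inl '' Set.range (beta K p.1.2) ∪ Sum.inr '' Set.range (beta K p.1.1) := by
  rw [config, (doubleEquiv K).symm.surjective.range_comp]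
  ext (n | n) <;> simp

lemma config_comp_perm_injective (K : ℕ) :
    Function.Injective fun x : RestrictedPair K × Equiv.Perm (Fin (2 * K)) => config x.1 ∘ x.2 := by
  rintro ⟨p, π⟩ ⟨p', π'⟩ h
  simp only at h
  have hr : Set.range (config p) = Set.range (config p') := by
    rw [← π.surjective.range_comp (config p), h, π'.surjective.range_comp]
  rw [range_config, range_config] at hr
  -- A strictly decreasing sequence is determined by its set of values.
  have anti_inj : ∀ {x y : Fin K → ℕ}, StrictAnti x → StrictAnti y → Set.range x = Set.range y →
      x = y := by
    intro x y hx hy hxy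
    have := (StrictMono.range_inj (hx.comp Fin.rev_strictAnti) (hy.comp Fin.rev_strictAnti)).mp (by
      rw [Fin.rev_surjective.range_comp, Fin.rev_surjective.range_comp, hxy])
    exact Fin.rev_surjective.injective_comp_right this
  have h2 : beta K p.1.2 = beta K p'.1.2 := by
    refine anti_inj (beta_strictAnti K _) (beta_strictAnti K _) (Set.ext fun n => ?_)
    simpa using Set.ext_iff.mp hr (Sum.inl n)
  have h1 : beta K p.1.1 = beta K p'.1.1 := by
    refine anti_inj (beta_strictAnti K _) (beta_strictAnti K _) (Set.ext fun n => ?_)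
    simpa using Set.ext_iff.mp hr (Sum.inr n)
  have hp : p = p' := Subtype.ext (Prod.ext (beta_injOn p.2.1 p'.2.1 h1)
    (beta_injOn p.2.2 p'.2.2 h2))
  subst hp
  exact Prod.ext rfl (Equiv.ext fun i => config_injective p (congrFun h i))

lemma exists_beta_range_eq {K : ℕ} (A : Finset ℕ) (hA : A.card = K) :
    ∃ Y : YoungDiagram, length Y ≤ K ∧ Set.range (beta K Y) = A := by
  obtain ⟨Y, hY, h⟩ := exists_beta_eq
    ((A.orderEmbOfFin hA).strictMono.comp_strictAnti Fin.rev_strictAnti)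
  refine ⟨Y, hY, ?_⟩
  rw [h, Fin.rev_surjective.range_comp, Finset.range_orderEmbOfFin]

lemma exists_config_comp_perm {K : ℕ} {f : Fin (2 * K) → ℕ ⊕ ℕ} (hf : Function.Injective f)
    (h0 : ∑ i, charge (f i) = 0) :
    ∃ (p : RestrictedPair K) (π : Equiv.Perm (Fin (2 * K))), config p ∘ π = f := by
  classical
  set u : Finset (ℕ ⊕ ℕ) := Finset.univ.image f with hu
  have hcard : u.toLeft.card + u.toRight.card = 2 * K := by
    rw [Finset.card_toLeft_add_card_toRight, hu, Finset.card_image_of_injective _ hf]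
    simp
  have hbal : (u.toLeft.card : ℤ) - u.toRight.card = 0 := by
    rw [← h0, ← Finset.sum_image (f := charge) (g := f) hf.injOn, ← hu,
      ← Finset.toLeft_disjSum_toRight (u := u), Finset.sum_disjSum]
    simp [charge, sub_eq_add_neg]
  obtain ⟨Z, hZ, hZr⟩ := exists_beta_range_eq (K := K) u.toLeft (by omega)
  obtain ⟨Y, hY, hYr⟩ := exists_beta_range_eq (K := K) u.toRight (by omega)
  set p : RestrictedPair K := ⟨(Y, Z), hY, hZ⟩
  have hr : Set.range f = Set.range (config p) := by
    rw [range_config, hZr, hYr]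
    ext (n | n) <;> simp [hu]
  refine ⟨p, (Equiv.ofInjective f hf).trans ((Equiv.setCongr hr).trans
    (Equiv.ofInjective _ (config_injective p)).symm), funext fun i => ?_⟩
  simp [Equiv.apply_ofInjective_symm]

/-- The sum over all balanced configurations is a sum over pairs of partitions. -/
lemma hasSum_config {K : ℕ} (a z : ℕ ⊕ ℕ → ℂ) {S : ℂ}
    (h : HasSum (fun f : Fin (2 * K) → ℕ ⊕ ℕ =>
      if ∑ i, charge (f i) = 0 then hankelTerm a z f else 0) S) :
    HasSum (fun p : RestrictedPair K => (∏ i, a (config p i)) *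
      (Matrix.vandermonde (z ∘ config p)).det ^ 2) S := by
  rw [← (config_comp_perm_injective K).hasSum_iff] at h
  · refine h.prod_fiberwise fun p => ?_
    rw [← sum_perm_hankelTerm]
    convert! hasSum_fintype fun π : Equiv.Perm (Fin (2 * K)) => hankelTerm a z (config p ∘ π)
      using 2 with π
    simp only [Function.comp_apply]
    rw [if_pos]
    rw [Equiv.sum_comp π fun i => charge (config p i), sum_charge_config]
  · intro f hf
    split_ifs with h0
    · refine hankelTerm_eq_zero_of_not_injective a z fun hinj => hf ?_
      obtain ⟨p, π, hp⟩ := exists_config_comp_perm hinj h0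
      exact ⟨(p, π), hp⟩
    · rfl

/-! ### Exponential series with super-exponentially small coefficients -/

/-- The majorant behind termwise differentiation on the disc of radius `R`. -/
lemma summable_mul_pow_mul_exp {c : ℕ → ℂ}
    (hc : ∀ r : ℝ, Summable fun k => ‖c k‖ * Real.exp (r * k))
    (τ : ℂ) (n : ℕ) {R : ℝ} (hR : 0 ≤ R) :
    Summable fun k : ℕ => ‖c k‖ * (Real.exp (R * ‖(k : ℂ) + τ‖) * ‖(k : ℂ) + τ‖ ^ n) := by
  refine Summable.of_nonneg_of_le (fun k => by positivity) (fun k => ?_)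
    ((hc (R + 1)).mul_left (n.factorial * Real.exp ((R + 1) * ‖τ‖)))
  have h1 : ‖(k : ℂ) + τ‖ ≤ k + ‖τ‖ := (norm_add_le _ _).trans (by simp)
  have h2 : ‖(k : ℂ) + τ‖ ^ n ≤ n.factorial * Real.exp ‖(k : ℂ) + τ‖ := by
    have := Real.pow_div_factorial_le_exp _ (norm_nonneg ((k : ℂ) + τ)) n
    rwa [div_le_iff₀' (by positivity)] at this
  calc ‖c k‖ * (Real.exp (R * ‖(k : ℂ) + τ‖) * ‖(k : ℂ) + τ‖ ^ n)
      ≤ ‖c k‖ * (Real.exp (R * ‖(k : ℂ) + τ‖) * (n.factorial * Real.exp ‖(k : ℂ) + τ‖)) := by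
        gcongr
    _ = ‖c k‖ * (n.factorial * Real.exp ((R + 1) * ‖(k : ℂ) + τ‖)) := by
        rw [add_mul, one_mul, Real.exp_add]
        ring
    _ ≤ ‖c k‖ * (n.factorial * Real.exp ((R + 1) * (k + ‖τ‖))) := by gcongr
    _ = n.factorial * Real.exp ((R + 1) * ‖τ‖) * (‖c k‖ * Real.exp ((R + 1) * k)) := by
        rw [mul_add (R + 1), Real.exp_add]
        ring

lemma norm_exp_mul_le (u w : ℂ) : ‖Complex.exp (u * w)‖ ≤ Real.exp (‖u‖ * ‖w‖) := by
  rw [Complex.norm_exp, ← norm_mul]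
  exact Real.exp_le_exp.mpr (Complex.re_le_norm _)

lemma summable_norm_exp_moment {c : ℕ → ℂ}
    (hc : ∀ r : ℝ, Summable fun k => ‖c k‖ * Real.exp (r * k)) (τ u : ℂ) (n : ℕ) :
    Summable fun k : ℕ => ‖c k * Complex.exp (u * (k + τ)) * (k + τ) ^ n‖ := by
  refine Summable.of_nonneg_of_le (fun k => norm_nonneg _) (fun k => ?_)
    (summable_mul_pow_mul_exp hc τ n (norm_nonneg u))
  rw [norm_mul, norm_mul, norm_pow, mul_assoc]
  gcongr
  exact norm_exp_mul_le _ _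

lemma hasDerivAt_tsum_exp_moment {c : ℕ → ℂ}
    (hc : ∀ r : ℝ, Summable fun k => ‖c k‖ * Real.exp (r * k)) (τ u : ℂ) (n : ℕ) :
    HasDerivAt (fun v => ∑' k : ℕ, c k * Complex.exp (v * (k + τ)) * (k + τ) ^ n)
      (∑' k : ℕ, c k * Complex.exp (u * (k + τ)) * (k + τ) ^ (n + 1)) u := by
  have hu : u ∈ Metric.ball (0 : ℂ) (‖u‖ + 1) := by simp
  have hbound := summable_mul_pow_mul_exp hc τ (n + 1) (R := ‖u‖ + 1) (by positivity)
  have hder : ∀ (k : ℕ) (v : ℂ), HasDerivAt (fun v => c k * Complex.exp (v * (k + τ)) * (k + τ) ^ n)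
      (c k * Complex.exp (v * (k + τ)) * (k + τ) ^ (n + 1)) v := by
    intro k v
    have h := (((hasDerivAt_id v).mul_const ((k : ℂ) + τ)).cexp.const_mul (c k)).mul_const
      (((k : ℂ) + τ) ^ n)
    simp only [id, one_mul] at h
    rwa [show c k * Complex.exp (v * (k + τ)) * (k + τ) ^ (n + 1) =
      c k * (Complex.exp (v * (k + τ)) * (k + τ)) * (k + τ) ^ n by ring]
  have hle : ∀ (k : ℕ) (v : ℂ), v ∈ Metric.ball (0 : ℂ) (‖u‖ + 1) →
      ‖c k * Complex.exp (v * (k + τ)) * (k + τ) ^ (n + 1)‖ ≤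
        ‖c k‖ * (Real.exp ((‖u‖ + 1) * ‖(k : ℂ) + τ‖) * ‖(k : ℂ) + τ‖ ^ (n + 1)) := by
    intro k v hv
    have hv' : ‖v‖ ≤ ‖u‖ + 1 := (mem_ball_zero_iff.mp hv).le
    rw [norm_mul, norm_mul, norm_pow, mul_assoc]
    gcongr
    exact (norm_exp_mul_le _ _).trans (by gcongr)
  have hsum : Summable fun k : ℕ => c k * Complex.exp (u * (k + τ)) * (k + τ) ^ n :=
    Summable.of_norm (summable_norm_exp_moment hc τ u n)
  exact hasDerivAt_tsum_of_isPreconnected hbound Metric.isOpen_ball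
    (convex_ball _ _).isPreconnected (fun k v _ => hder k v) hle hu hsum hu

/-! ### The hypergeometric series and the moment generating function -/

lemma hypTerm_eq (b z : ℂ) (n : ℕ) : hypTerm [] [b, b, 1] z n =
    (((ascPochhammer ℂ n).eval b * n.factorial) ^ 2)⁻¹ * z ^ n := by
  have h : (n.factorial : ℂ) ≠ 0 := by exact_mod_cast n.factorial_ne_zero
  simp only [hypTerm, List.map_nil, List.prod_nil, List.map_cons, List.prod_cons, mul_one,
    ascPochhammer_eval_one]
  field_simp

lemma summable_norm_hypTerm (b z : ℂ) : Summable fun n => ‖hypTerm [] [b, b, 1] z n‖ := by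
  refine summable_of_ratio_norm_eventually_le (r := 1 / 2) (by norm_num) ?_
  filter_upwards [Filter.eventually_ge_atTop (Nat.ceil (‖b‖ + 1 + 2 * ‖z‖))] with n hn
  have hn' : ‖b‖ + 1 + 2 * ‖z‖ ≤ n := Nat.ceil_le.mp hn
  have hz := norm_nonneg z
  have hb := norm_nonneg b
  have h1 : 1 ≤ ‖b + n‖ := by
    have := norm_sub_norm_le (n : ℂ) (-b)
    rw [sub_neg_eq_add, norm_neg, add_comm, Complex.norm_natCast] at this
    linarith
  have h2 : hypTerm [] [b, b, 1] z (n + 1) =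
      z * ((b + n) ^ 2 * (n + 1) ^ 2)⁻¹ * hypTerm [] [b, b, 1] z n := by
    rw [hypTerm_eq, hypTerm_eq, ascPochhammer_succ_eval, Nat.factorial_succ]
    push_cast
    simp only [mul_inv, mul_pow]
    ring
  rw [norm_norm, norm_norm, h2, norm_mul]
  gcongr
  have h3 : ‖((n : ℂ) + 1)‖ = n + 1 := by
    rw [← Nat.cast_add_one, Complex.norm_natCast, Nat.cast_add_one]
  rw [norm_mul, norm_inv, norm_mul, norm_pow, norm_pow, h3, ← div_eq_mul_inv,
    div_le_iff₀ (by positivity)]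
  have h4 : 1 ≤ ‖b + n‖ ^ 2 := one_le_pow₀ h1
  nlinarith

/-- The weight at the points `k + σ`, namely `1 / (Γ(k + 1 + 2σ)² k!²)`. -/
def latticeWeight (σ : ℂ) (k : ℕ) : ℂ :=
  (Complex.Gamma (1 + 2 * σ + k) ^ 2 * (k.factorial : ℂ) ^ 2)⁻¹

lemma weight_add (K : ℕ) (σ : ℂ) (k : ℕ) : weight [] K σ (k + σ) = latticeWeight σ k := by
  rw [weight_nil, latticeWeight, ← Complex.Gamma_nat_eq_factorial]
  ring_nf

lemma weight_sub (K : ℕ) (σ : ℂ) (k : ℕ) : weight [] K σ (k - σ) = latticeWeight (-σ) k := by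
  rw [weight_nil, latticeWeight, ← Complex.Gamma_nat_eq_factorial]
  ring_nf

lemma Gamma_add_nat_eq (b : ℂ) (hb : ∀ m : ℕ, b ≠ -m) (n : ℕ) :
    Complex.Gamma (b + n) = (ascPochhammer ℂ n).eval b * Complex.Gamma b := by
  induction n with
  | zero => simp
  | succ n ih =>
    rw [ascPochhammer_succ_eval, mul_right_comm, ← ih, Nat.cast_add_one, ← add_assoc,
      Complex.Gamma_add_one _ fun h => hb n (by linear_combination h), mul_comm]

lemma latticeWeight_mul_pow {σ : ℂ} (hσ : ∀ n : ℤ, 2 * σ ≠ n) (z : ℂ) (k : ℕ) :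
    latticeWeight σ k * z ^ k =
      (Complex.Gamma (1 + 2 * σ) ^ 2)⁻¹ * hypTerm [] [1 + 2 * σ, 1 + 2 * σ, 1] z k := by
  rw [latticeWeight, Gamma_add_nat_eq _ (fun m h => hσ (-m - 1) (by
    push_cast; linear_combination h)), hypTerm_eq]
  simp only [mul_inv, mul_pow]
  ring

lemma summable_latticeWeight_mul_exp {σ : ℂ} (hσ : ∀ n : ℤ, 2 * σ ≠ n) (r : ℝ) :
    Summable fun k : ℕ => ‖latticeWeight σ k‖ * Real.exp (r * k) := by
  have h := (summable_norm_hypTerm (1 + 2 * σ) (Real.exp r)).mul_left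
    ‖(Complex.Gamma (1 + 2 * σ) ^ 2)⁻¹‖
  refine h.congr fun k => ?_
  rw [← norm_mul, ← latticeWeight_mul_pow hσ, norm_mul, norm_pow, Complex.norm_real,
    Real.norm_eq_abs, Real.abs_exp, mul_comm r, Real.exp_nat_mul]

lemma latticeWeight_mul_exp {σ : ℂ} (hσ : ∀ n : ℤ, 2 * σ ≠ n) (u : ℂ) (k : ℕ) :
    latticeWeight σ k * Complex.exp (u * (k + σ)) =
      Complex.exp (u * σ) / Complex.Gamma (1 + 2 * σ) ^ 2 *
        hypTerm [] [1 + 2 * σ, 1 + 2 * σ, 1] (Complex.exp u) k := by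
  rw [mul_add, Complex.exp_add, mul_comm u k, Complex.exp_nat_mul, ← mul_assoc,
    latticeWeight_mul_pow hσ]
  ring

/-- The `n`-th exponential moment `∑ₖ w(k + σ) e^{u (k + σ)} (k + σ)ⁿ` of one of the lattices. -/
def latticeMoment (σ : ℂ) (n : ℕ) (u : ℂ) : ℂ :=
  ∑' k : ℕ, latticeWeight σ k * Complex.exp (u * (k + σ)) * (k + σ) ^ n

lemma latticeMoment_zero {σ : ℂ} (hσ : ∀ n : ℤ, 2 * σ ≠ n) (u : ℂ) : latticeMoment σ 0 u =
    Complex.exp (u * σ) / Complex.Gamma (1 + 2 * σ) ^ 2 *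
      hyp [] [1 + 2 * σ, 1 + 2 * σ, 1] (Complex.exp u) := by
  simp only [latticeMoment, pow_zero, mul_one, latticeWeight_mul_exp hσ, tsum_mul_left, hyp]

lemma two_mul_neg_ne_int {σ : ℂ} (hσ : ∀ n : ℤ, 2 * σ ≠ n) (n : ℤ) : 2 * -σ ≠ n := fun h =>
  hσ (-n) (by push_cast; linear_combination -h)

lemma psi_eq {σ : ℂ} (hσ : ∀ n : ℤ, 2 * σ ≠ n) (q : ℂ) :
    psi σ q = fun u => q * latticeMoment σ 0 u + q⁻¹ * latticeMoment (-σ) 0 u := by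
  funext u
  rw [latticeMoment_zero hσ, latticeMoment_zero (two_mul_neg_ne_int hσ), psi, mul_neg, mul_neg,
    ← sub_eq_add_neg]
  ring

lemma hasDerivAt_latticeMoment {σ : ℂ} (hσ : ∀ n : ℤ, 2 * σ ≠ n) (n : ℕ) (u : ℂ) :
    HasDerivAt (latticeMoment σ n) (latticeMoment σ (n + 1) u) u :=
  hasDerivAt_tsum_exp_moment (summable_latticeWeight_mul_exp hσ) σ u n

lemma iteratedDeriv_psi {σ : ℂ} (hσ : ∀ n : ℤ, 2 * σ ≠ n) (q : ℂ) (n : ℕ) :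
    iteratedDeriv n (psi σ q) =
      fun u => q * latticeMoment σ n u + q⁻¹ * latticeMoment (-σ) n u := by
  induction n with
  | zero => rw [iteratedDeriv_zero, psi_eq hσ]
  | succ n ih =>
    rw [iteratedDeriv_succ, ih]
    funext u
    exact (((hasDerivAt_latticeMoment hσ n u).const_mul q).add
      ((hasDerivAt_latticeMoment (two_mul_neg_ne_int hσ) n u).const_mul q⁻¹)).deriv

lemma differentiable_psi {σ : ℂ} (hσ : ∀ n : ℤ, 2 * σ ≠ n) (q : ℂ) :
    Differentiable ℂ (psi σ q) := by
  rw [psi_eq hσ]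
  exact fun u => (((hasDerivAt_latticeMoment hσ 0 u).const_mul q).add
    ((hasDerivAt_latticeMoment (two_mul_neg_ne_int hσ) 0 u).const_mul q⁻¹)).differentiableAt

lemma summable_latticeMoment {σ : ℂ} (hσ : ∀ n : ℤ, 2 * σ ≠ n) (u : ℂ) (n : ℕ) :
    Summable fun k : ℕ => ‖latticeWeight σ k * Complex.exp (u * (k + σ)) * (k + σ) ^ n‖ :=
  summable_norm_exp_moment (summable_latticeWeight_mul_exp hσ) σ u n

lemma nuIntegrable_exp {σ : ℂ} (hσ : ∀ n : ℤ, 2 * σ ≠ n) (K : ℕ) (u : ℂ) :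
    NuIntegrable [] K σ fun z => Complex.exp (u * z) := by
  have h1 := (summable_latticeMoment hσ u 0).of_norm
  have h2 := (summable_latticeMoment (two_mul_neg_ne_int hσ) u 0).of_norm
  simp only [pow_zero, mul_one, ← sub_eq_add_neg] at h1 h2
  simp only [NuIntegrable, weight_add, weight_sub]
  exact ⟨h1, h2⟩

lemma mgf_eq_psi {σ : ℂ} (hσ : ∀ n : ℤ, 2 * σ ≠ n) (K : ℕ) (q u : ℂ) :
    mgf [] K σ q u = psi σ q u := by
  rw [psi_eq hσ]
  simp only [mgf, nuIntegral, weight_add, weight_sub, latticeMoment, pow_zero, mul_one,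
    ← sub_eq_add_neg]

/-! ### The restricted sum over pairs of partitions -/

/-- The position of a point: `k + σ` for the left summand, `k - σ` for the right one. -/
def node (σ : ℂ) : ℕ ⊕ ℕ → ℂ := Sum.elim (fun k => (k : ℂ) + σ) fun k => (k : ℂ) + -σ

/-- The mass `w(z) e^{uz}` of a point, without the power of `q` given by its charge. -/
def mass (σ u : ℂ) : ℕ ⊕ ℕ → ℂ :=
  Sum.elim (fun k => latticeWeight σ k * Complex.exp (u * (k + σ)))
    fun k => latticeWeight (-σ) k * Complex.exp (u * (k + -σ))

lemma summable_norm_mass_mul {σ : ℂ} (hσ : ∀ n : ℤ, 2 * σ ≠ n) (q u : ℂ) (n : ℕ) :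
    Summable fun x => ‖q ^ charge x * mass σ u x * node σ x ^ n‖ := by
  refine Summable.sum _ ?_ ?_
  · have h := (summable_latticeMoment hσ u n).mul_left ‖q‖
    refine h.congr fun k => ?_
    simp only [Function.comp_apply, charge, mass, node, Sum.elim_inl, zpow_one, norm_mul, mul_assoc]
  · have h := (summable_latticeMoment (two_mul_neg_ne_int hσ) u n).mul_left ‖q⁻¹‖
    refine h.congr fun k => ?_
    simp only [Function.comp_apply, charge, mass, node, Sum.elim_inr, zpow_neg_one, norm_mul,
      mul_assoc]

lemma hankel_psi_eq {σ : ℂ} (hσ : ∀ n : ℤ, 2 * σ ≠ n) (K : ℕ) (q u : ℂ) :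
    hankel K (psi σ q) u = (Matrix.of fun i j : Fin (2 * K) =>
      ∑' x, q ^ charge x * mass σ u x * node σ x ^ ((i : ℕ) + j)).det := by
  rw [hankel]
  congr 2
  funext i j
  have h := (summable_norm_mass_mul hσ q u (i + j)).of_norm
  rw [iteratedDeriv_psi hσ, Summable.tsum_sum (h.comp_injective Sum.inl_injective)
    (h.comp_injective Sum.inr_injective)]
  simp only [latticeMoment, ← tsum_mul_left]
  simp only [charge, mass, node, Sum.elim_inl, Sum.elim_inr, zpow_one, zpow_neg_one, mul_assoc]

lemma hankelTerm_zpow_charge {N : ℕ} (a z : ℕ ⊕ ℕ → ℂ) {q : ℂ} (hq : q ≠ 0)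
    (f : Fin N → ℕ ⊕ ℕ) :
    hankelTerm (fun x => q ^ charge x * a x) z f = q ^ (∑ i, charge (f i)) * hankelTerm a z f := by
  have h : ∏ i, q ^ charge (f i) = q ^ (∑ i, charge (f i)) := by
    induction (Finset.univ : Finset (Fin N)) using Finset.cons_induction with
    | empty => simp
    | cons i s hi ih => rw [Finset.prod_cons, Finset.sum_cons, zpow_add₀ hq, ih]
  simp only [hankelTerm, Finset.prod_mul_distrib, h]
  ring

lemma circleIntegrable_hankel_psi {σ : ℂ} (hσ : ∀ n : ℤ, 2 * σ ≠ n) (K : ℕ) (u : ℂ) :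
    CircleIntegrable (fun q : ℂ => hankel K (psi σ q) u / q) 0 1 := by
  -- The integrand is a Laurent polynomial in `q`.
  refine ContinuousOn.circleIntegrable zero_le_one ?_
  have h0 : ∀ q ∈ Metric.sphere (0 : ℂ) 1, q ≠ 0 := fun q hq =>
    ne_zero_of_mem_unit_sphere (⟨q, hq⟩ : Metric.sphere (0 : ℂ) 1)
  refine ContinuousOn.div ?_ continuousOn_id h0
  simp only [hankel, iteratedDeriv_psi hσ, Matrix.det_apply, Matrix.of_apply]
  have hinv : ContinuousOn (fun q : ℂ => q⁻¹) (Metric.sphere 0 1) := continuousOn_id.inv₀ h0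
  fun_prop

/-- The contribution of a pair of partitions to the constant term is its block coefficient. -/
lemma config_term_eq {σ : ℂ} (hσ : ∀ n : ℤ, 2 * σ ≠ n) (u : ℂ) {K : ℕ} (p : RestrictedPair K) :
    B [] σ p.1.1 p.1.2 * Complex.exp (u * ((p.1.1.card : ℂ) + (p.1.2.card : ℂ))) =
      Complex.Gamma (2 * σ) ^ (2 * K) * Complex.Gamma (1 - 2 * σ) ^ (2 * K) /
            Complex.exp u ^ (K * (K - 1)) * ((∏ i, mass σ u (config p i)) *
      (Matrix.vandermonde (node σ ∘ config p)).det ^ 2) := by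
  have hnode : node σ ∘ config p = Sum.elim (fun i => (beta K p.1.2 i : ℂ) + σ)
      (fun i => beta K p.1.1 i - σ) ∘ (doubleEquiv K).symm := by
    funext i
    simp only [Function.comp_apply, config, node]
    rcases (doubleEquiv K).symm i with k | k <;> simp [sub_eq_add_neg]
  have hexp : ∏ i, mass σ u (config p i) =
      (∏ i, (weight [] K σ (beta K p.1.2 i + σ) * weight [] K σ (beta K p.1.1 i - σ))) *
        (Complex.exp (u * ((p.1.1.card : ℂ) + (p.1.2.card : ℂ))) *
          Complex.exp u ^ (K * (K - 1))) := by
    -- Each sequence of beta numbers exceeds the row lengths by `K (K - 1) / 2` in total, and the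
    -- shifts `σ` and `-σ` cancel.
    have hcard : ∑ i, (((beta K p.1.2 i : ℂ) + σ) + (beta K p.1.1 i + -σ)) =
        (p.1.1.card : ℂ) + p.1.2.card + (K * (K - 1) : ℕ) := by
      have h1 := card_add_eq_sum_beta p.2.1
      have h2 := card_add_eq_sum_beta p.2.2
      have h3 := Nat.div_mul_cancel (Nat.even_mul_pred_self K).two_dvd
      have h4 : ∑ i, (beta K p.1.2 i + beta K p.1.1 i) =
          p.1.1.card + p.1.2.card + K * (K - 1) := by
        rw [Finset.sum_add_distrib]
        omega
      rw [← Nat.cast_add, ← Nat.cast_add, ← h4, Nat.cast_sum]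
      refine Finset.sum_congr rfl fun i _ => ?_
      push_cast
      ring
    rw [prod_config, ← Complex.exp_nat_mul, ← Complex.exp_add, mul_comm (_ : ℂ) u, ← mul_add,
      ← hcard, Finset.mul_sum, Complex.exp_sum, ← Finset.prod_mul_distrib,
      ← Finset.prod_mul_distrib]
    refine Finset.prod_congr rfl fun i _ => ?_
    simp only [mass, Sum.elim_inl, Sum.elim_inr, weight_add, weight_sub]
    rw [mul_add u ((beta K p.1.2 i : ℂ) + σ), Complex.exp_add]
    ring
  rw [hexp, hnode, B_eq p.2.1 p.2.2 σ hσ]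
  have := Complex.exp_ne_zero u
  field_simp

theorem hasSum_restricted {σ : ℂ} (hσ : ∀ n : ℤ, 2 * σ ≠ n) (K : ℕ) (u : ℂ) :
    HasSum (fun p : RestrictedPair K =>
        B [] σ p.1.1 p.1.2 * Complex.exp (u * ((p.1.1.card : ℂ) + (p.1.2.card : ℂ))))
      (Complex.Gamma (2 * σ) ^ (2 * K) * Complex.Gamma (1 - 2 * σ) ^ (2 * K) /
          Complex.exp u ^ (K * (K - 1)) *
        ((2 * (Real.pi : ℂ) * Complex.I)⁻¹ *
          ∮ q in C(0, 1), hankel K (psi σ q) u / q)) := by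
  simp only [config_term_eq hσ]
  apply HasSum.mul_left
  apply hasSum_config
  refine hasSum_constant_term ?_ _ fun q hq => ?_
  · refine (summable_norm_and_hasSum_hankelTerm _ _ fun n => ?_).1
    simpa only [one_zpow, one_mul] using summable_norm_mass_mul hσ 1 u n
  · simp only [← hankelTerm_zpow_charge _ _ hq, hankel_psi_eq hσ]
    exact (summable_norm_and_hasSum_hankelTerm _ _ fun n =>
      summable_norm_mass_mul hσ q u n).2

end PainleveIII

end

theorem mainTheorem5 (σ : ℂ) (hσ : ∀ n : ℤ, 2 * σ ≠ (n : ℂ)) :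
    -- the two hypergeometric series converge everywhere
    (∀ z : ℂ,
      Summable (PainleveIII.hypTerm [] [1 + 2 * σ, 1 + 2 * σ, 1] z) ∧
      Summable (PainleveIII.hypTerm [] [1 - 2 * σ, 1 - 2 * σ, 1] z)) ∧
    -- `ψ` is entire, and for every `K` it is the moment generating function of the measure `ν`
    (∀ q : ℂ, q ≠ 0 →
      Differentiable ℂ (PainleveIII.psi σ q) ∧
      ∀ K : ℕ, 1 ≤ K → ∀ u : ℂ,
        PainleveIII.NuIntegrable [] K σ (fun z => Complex.exp (u * z)) ∧
        PainleveIII.mgf [] K σ q u = PainleveIII.psi σ q u) ∧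
    -- the restricted partial sum as a contour integral of the Hankel determinant
    ∀ K : ℕ, 1 ≤ K → ∀ u : ℂ,
      CircleIntegrable (fun q : ℂ => PainleveIII.hankel K (PainleveIII.psi σ q) u / q) 0 1 ∧
      HasSum
        (fun p : PainleveIII.RestrictedPair K =>
          PainleveIII.B [] σ p.1.1 p.1.2 *
            Complex.exp (u * ((p.1.1.card : ℂ) + (p.1.2.card : ℂ))))
        (Complex.Gamma (2 * σ) ^ (2 * K) * Complex.Gamma (1 - 2 * σ) ^ (2 * K) /
            Complex.exp u ^ (K * (K - 1)) *
          ((2 * (Real.pi : ℂ) * Complex.I)⁻¹ *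
            ∮ q in C(0, 1), PainleveIII.hankel K (PainleveIII.psi σ q) u / q)) :=
  ⟨fun z => ⟨(PainleveIII.summable_norm_hypTerm _ z).of_norm,
      (PainleveIII.summable_norm_hypTerm _ z).of_norm⟩,
    fun q _ => ⟨PainleveIII.differentiable_psi hσ q, fun K _ u =>
      ⟨PainleveIII.nuIntegrable_exp hσ K u, PainleveIII.mgf_eq_psi hσ K q u⟩⟩,
    fun K _ u => ⟨PainleveIII.circleIntegrable_hankel_psi hσ K u,
      PainleveIII.hasSum_restricted hσ K u⟩⟩
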